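/- Conventions. Each mode has two quadratures $(X,P)$; $J=\bigoplus_k J_1$ with $J_1=\begin{pmatrix}0&-1\\1&0\end{pmatrix}$ is the symplectic form. The covariance matrix (CM) of a pure $n$-mode Gaussian state is a real symmetric strictly positive $2n\times 2n$ matrix $\gamma$ with $\gamma+J\gamma^{-1}J=0$. For a three-mode CM let $\gamma_{ij}$ be the $2\times2$ block of covariances between the modes $i$ and $j$. A Gaussian operation on three modes is described, via the Choi–Jamiołkowski isomorphism, by a six-mode CM $\Gamma=\begin{pmatrix}\Gamma_1&\Gamma_{12}\\ \Gamma_{12}^T&\Gamma_2\end{pmatrix}$ (index 1: three output modes, index 2: three input modes), and maps $\gamma$ to $$\gamma'=\Gamma_1-\Gamma_{12}\,(\Gamma_2+\Lambda\gamma\Lambda)^{-1}\,\Gamma_{12}^T,\qquad \Lambda=\sigma_z\oplus\sigma_z\oplus\sigma_z .$$ It is a pure Gaussian LOCC (GLOCC) if $\Gamma=\bigoplus_{x=1}^3\Gamma_x$, where $\Gamma_x$ is a pure two-mode CM on the output and input modes of party $x$. It is a GLOCC if its Choi–Jamiołkowski state is separable over the three parties, i.e. $\Gamma\ge\bigoplus_{x=1}^3\Gamma_x$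 for some pure two-mode CMs $\Gamma_x$. We say that $\gamma$ can be transformed into $\gamma'$ by (pure) GLOCC if $\gamma'$ is an output, or a limit of outputs, of (pure) GLOCC applied to $\gamma$; the limits cover infinitely squeezed $\Gamma$, e.g. not acting on a mode. Lemma. Let $\gamma$ be the CM of a pure three-mode Gaussian state with $\det\gamma_{ij}\le 0$ for all $i\ne j$. 1. If $\gamma$ can be transformed into $\gamma'$ by pure GLOCC, then $\det\gamma'_{ij}\le 0$ for all $i\neq j$. 2. If $\gamma$ can be transformed into $\gamma'$ by GLOCC and $\gamma'$ is the CM of a pure state, then $\det\gamma'_{ij}\le0$ for all $i\ne j$. Consequence. For $\lambda\ge1$ let $\gamma_{\rm sym}(\lambda)$ be the symmetric (CV GHZ/W) state, with diagonal blocks $\lambda\mathbb 1$ and all off-diagonal blocks equal to $\mathrm{diag}(d^+,d^-)$, $d^\pm=\frac1{4\lambda}\bigl(\lambda^2-1\pm\sqrt{9\lambda^4-10\lambda^2+1}\bigr)$. For $s>0$ and $\theta\in\mathbb R$ with $\sin\theta\cos\theta\ne0$ let $$\gamma(s,\theta)=B(\theta)\,[\gamma_{\rm tms}(s)\oplus\mathbb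 1]\,B(\theta)^T,\quad \gamma_{\rm tms}(s)=\begin{pmatrix}\cosh s\,\mathbb 1&\sinh s\,\sigma_z\\ \sinh s\,\sigma_z&\cosh s\,\mathbb 1\end{pmatrix},\quad B(\theta)=\mathbb 1\oplus\begin{pmatrix}\cos\theta\,\mathbb 1&\sin\theta\,\mathbb 1\\-\sin\theta\,\mathbb 1&\cos\theta\,\mathbb 1\end{pmatrix}$$ be the distributed two-mode squeezed state. Then $\gamma(s,\theta)$ is the CM of a pure state, and no $\gamma_{\rm sym}(\lambda)$, $\lambda\ge 1$, can be transformed into it by GLOCC. In particular the symmetric states do not reach all pure three-mode Gaussian states. -/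

import Mathlib

open scoped Kronecker

noncomputable section

namespace GLOCC

/-- Pauli matrix `σ_z`. -/
def sigmaZ : Matrix (Fin 2) (Fin 2) ℝ := !![1, 0; 0, -1]

/-- The form `J = ⊕ J₁` over the set `M` of modes. A phase-space index is a pair
(mode, quadrature), the quadrature `0` being `X` and the quadrature `1` being `P`. -/
def sympJ (M : Type*) [DecidableEq M] : Matrix (M × Fin 2) (M × Fin 2) ℝ :=
  (1 : Matrix M M ℝ) ⊗ₖ !![0, -1; 1, 0]

/-- `γ` is the covariance matrix of a pure Gaussian state: it is real, symmetric, strictly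
positive, and the uncertainty relation `γ + J γ⁻¹ J ≥ 0` holds with equality. -/
def IsPureCM {M : Type*} [Fintype M] [DecidableEq M]
    (γ : Matrix (M × Fin 2) (M × Fin 2) ℝ) : Prop :=
  γ.PosDef ∧ γ + sympJ M * γ⁻¹ * sympJ M = 0

/-- The `2 × 2` block of covariances between the modes `i` and `j`. -/
def modeBlock {M : Type*} (γ : Matrix (M × Fin 2) (M × Fin 2) ℝ) (i j : M) :
    Matrix (Fin 2) (Fin 2) ℝ :=
  γ.submatrix (fun q => (i, q)) (fun q => (j, q))

/-- All off-diagonal blocks have non-positive determinant. -/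
def NonposDets {M : Type*} (γ : Matrix (M × Fin 2) (M × Fin 2) ℝ) : Prop :=
  ∀ i j, i ≠ j → (modeBlock γ i j).det ≤ 0

/-- Covariance matrices of three modes. -/
abbrev CM3 := Matrix (Fin 3 × Fin 2) (Fin 3 × Fin 2) ℝ

/-- Covariance matrices of two modes: mode `0` is the output port and mode `1` the input
port of one party. -/
abbrev LocalCJ := Matrix (Fin 2 × Fin 2) (Fin 2 × Fin 2) ℝ

/-- Choi–Jamiołkowski covariance matrices of operations on three modes: the six modes are
pairs (party, port), the port `0` being the output and the port `1` the input. -/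
abbrev CJ3 := Matrix ((Fin 3 × Fin 2) × Fin 2) ((Fin 3 × Fin 2) × Fin 2) ℝ

/-- The block `Γ_{ab}` of a Choi–Jamiołkowski covariance matrix between the three modes of
port `a` and the three modes of port `b`. -/
def portBlock (Γ : CJ3) (a b : Fin 2) : CM3 :=
  Γ.submatrix (fun k => ((k.1, a), k.2)) (fun k => ((k.1, b), k.2))

/-- `Λ = σ_z ⊕ σ_z ⊕ σ_z`. -/
def Lam : CM3 := (1 : Matrix (Fin 3) (Fin 3) ℝ) ⊗ₖ sigmaZ

/-- `γ' = Γ₁ - Γ₁₂ (Γ₂ + Λ γ Λ)⁻¹ Γ₁₂ᵀ`: the covariance matrix to which the operation with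
Choi–Jamiołkowski covariance matrix `Γ` takes `γ`. -/
def output (Γ : CJ3) (γ : CM3) : CM3 :=
  portBlock Γ 0 0 -
    portBlock Γ 0 1 * (portBlock Γ 1 1 + Lam * γ * Lam)⁻¹ * (portBlock Γ 0 1).transpose

/-- The direct sum `⊕_x G_x` over the three parties. -/
def localSum (G : Fin 3 → LocalCJ) : CJ3 :=
  Matrix.of fun k l => if k.1.1 = l.1.1 then G k.1.1 (k.1.2, k.2) (l.1.2, l.2) else 0

/-- Pure Gaussian LOCC: the Choi–Jamiołkowski state is a product, over the three parties, of
pure two-mode Gaussian states. -/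
def IsPureGLOCC (Γ : CJ3) : Prop :=
  ∃ G : Fin 3 → LocalCJ, (∀ x, IsPureCM (G x)) ∧ Γ = localSum G

/-- Gaussian LOCC, possibly mixed: the Choi–Jamiołkowski state is separable over the three
parties, i.e. a mixture of displaced pure product states, i.e. its covariance matrix
dominates that of a pure product state. -/
def IsGLOCC (Γ : CJ3) : Prop :=
  ∃ G : Fin 3 → LocalCJ, (∀ x, IsPureCM (G x)) ∧ (Γ - localSum G).PosSemidef

/-- Pure Gaussian LOCC takes `γ` to `γ'`. The closure adds the operations whose
Choi–Jamiołkowski state is infinitely squeezed, such as not acting on a mode. -/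
def PureReaches (γ γ' : CM3) : Prop :=
  γ' ∈ closure {δ | ∃ Γ, IsPureGLOCC Γ ∧ δ = output Γ γ}

/-- Gaussian LOCC takes `γ` to `γ'`, infinitely squeezed Choi–Jamiołkowski states included. -/
def Reaches (γ γ' : CM3) : Prop :=
  γ' ∈ closure {δ | ∃ Γ, IsGLOCC Γ ∧ δ = output Γ γ}

/-- The entries `d⁺` (for `ε = 1`) and `d⁻` (for `ε = -1`) of the symmetric state. -/
def symEntry (ε l : ℝ) : ℝ :=
  ((l ^ 2 - 1) + ε * √(9 * l ^ 4 - 10 * l ^ 2 + 1)) / (4 * l)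

/-- The symmetric (CV GHZ/W) state `γ_sym(l)`: diagonal blocks `l • 1`, off-diagonal blocks
`diag(d⁺, d⁻)`. -/
def symState (l : ℝ) : CM3 :=
  l • (1 : CM3) +
    !![0, 1, 1; 1, 0, 1; 1, 1, 0] ⊗ₖ !![symEntry 1 l, 0; 0, symEntry (-1) l]

/-- A two-mode squeezed vacuum of modes `0`, `1`, and mode `2` in the vacuum. -/
def tmsVacuum (s : ℝ) : CM3 :=
  !![Real.cosh s, 0, 0; 0, Real.cosh s, 0; 0, 0, 1] ⊗ₖ (1 : Matrix (Fin 2) (Fin 2) ℝ) +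
    !![0, Real.sinh s, 0; Real.sinh s, 0, 0; 0, 0, 0] ⊗ₖ sigmaZ

/-- A beam splitter on the modes `1`, `2`. -/
def beamSplitter (θ : ℝ) : CM3 :=
  !![1, 0, 0; 0, Real.cos θ, Real.sin θ; 0, -Real.sin θ, Real.cos θ] ⊗ₖ
    (1 : Matrix (Fin 2) (Fin 2) ℝ)

/-- The distributed two-mode squeezed state `γ(s, θ)`. -/
def distributedTMS (s θ : ℝ) : CM3 :=
  beamSplitter θ * tmsVacuum s * (beamSplitter θ).transpose

end GLOCC

end

/-
Apart from a sign, the block between the parties `i ≠ j` of an output is `C_i (M⁻¹)_ij C_jᵀ`, where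
`C_x` is the output-input block of the state of party `x` and `M` is `Λ γ Λ` with its diagonal
blocks shifted by the input blocks `B_x`. As `C_x` is the off-diagonal block of a pure two-mode
state, `det C_x ≤ 0`, so it remains to see that `det (M⁻¹)_ij ≤ 0`. By Jacobi's identity for
complementary minors this has the sign of the determinant with the rows `i, k` and the columns
`j, k` of `Λ γ Λ`, shifted by `B_k` in the block `kk`, where `k` is the third mode. Write
`B_k = t B` with `det B = 1`. This determinant is a quadratic in `t` whose constant and leading
coefficients are both `det γ_ij ≤ 0`. At `t = 1` it is, up to a positive factor, the off-diagonal
determinant of the pure two-mode state that remains when mode `k` is projected onto `B`, hence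
nonpositive, and so it is nonpositive for all `t > 0`.

For mixed operations the output dominates that of the pure product operation below it. The
matrices dominated by a given one and positive semidefinite form a compact set, so a limit of
outputs dominates a limit of pure outputs, and a pure covariance matrix dominates no other pure one.
-/

namespace GLOCC

open Matrix

section Determinant

variable {R k m n : Type*} [CommRing R] [Fintype k] [DecidableEq k] [Fintype m] [DecidableEq m]
  [Fintype n] [DecidableEq n]

/-- Jacobi's identity for complementary minors, where `r` and `c` list the rows and the columns in
the order (kept, deleted). -/
theorem det_submatrix_inv_mul_det_submatrix {A : Matrix k k R} (hA : IsUnit A.det)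
    (r c : n ⊕ m ≃ k) :
    (A⁻¹.submatrix (c ∘ Sum.inr) (r ∘ Sum.inr)).det * (A.submatrix r c).det =
      (A.submatrix (r ∘ Sum.inl) (c ∘ Sum.inl)).det := by
  set N := A.submatrix r c
  set P := A⁻¹.submatrix c r
  have hNP : N * P = 1 := by
    rw [submatrix_mul_equiv, mul_nonsing_inv _ hA, submatrix_one_equiv]
  rw [← fromBlocks_toBlocks N, ← fromBlocks_toBlocks P, fromBlocks_multiply, ← fromBlocks_one,
    fromBlocks_inj] at hNP
  have htri : N * fromBlocks 1 P.toBlocks₁₂ 0 P.toBlocks₂₂ =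
      fromBlocks N.toBlocks₁₁ 0 N.toBlocks₂₁ 1 := by
    conv_lhs => rw [← fromBlocks_toBlocks N, fromBlocks_multiply]
    simp only [Matrix.mul_one, Matrix.mul_zero, add_zero, hNP.2.1, hNP.2.2.2]
  have hdet := congrArg det htri
  rw [det_mul, det_fromBlocks_zero₂₁, det_fromBlocks_zero₁₂, det_one, det_one, one_mul, mul_one,
    mul_comm] at hdet
  exact hdet

theorem det_fromBlocks_add_smul (X : Matrix m m R) (Y : Matrix m (Fin 2) R)
    (Z : Matrix (Fin 2) m R) (K B : Matrix (Fin 2) (Fin 2) R) :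
    ∃ q, ∀ t, (fromBlocks X Y Z (K + t • B)).det =
      (fromBlocks X Y Z K).det + q * t + X.det * B.det * t ^ 2 := by
  let rows (u v : m ⊕ Fin 2 → R) : Matrix (m ⊕ Fin 2) (m ⊕ Fin 2) R :=
    ((fromBlocks X Y Z K).updateRow (Sum.inr 0) u).updateRow (Sum.inr 1) v
  have hrows (Z' : Matrix (Fin 2) m R) (K' : Matrix (Fin 2) (Fin 2) R) :
      fromBlocks X Y Z' K' = rows (Sum.elim (Z' 0) (K' 0)) (Sum.elim (Z' 1) (K' 1)) := by
    ext (i | i) (j | j) <;> try fin_cases i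
    all_goals simp [rows, updateRow_apply]
  have hne : (Sum.inr 0 : m ⊕ Fin 2) ≠ Sum.inr 1 := by simp
  have hleft (u u' v t) : (rows (u + t • u') v).det = (rows u v).det + t * (rows u' v).det := by
    simp only [rows, updateRow_comm _ hne, det_updateRow_add, det_updateRow_smul]
  have hright (u v v' t) : (rows u (v + t • v')).det = (rows u v).det + t * (rows u v').det := by
    simp only [rows, det_updateRow_add, det_updateRow_smul]
  have hsplit (t : R) (i : Fin 2) :
      Sum.elim (Z i) ((K + t • B) i) = Sum.elim (Z i) (K i) + t • Sum.elim (0 : m → R) (B i) := by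
    ext (j | j) <;> simp
  refine ⟨(rows (Sum.elim 0 (B 0)) (Sum.elim (Z 1) (K 1))).det +
    (rows (Sum.elim (Z 0) (K 0)) (Sum.elim 0 (B 1))).det, fun t => ?_⟩
  have htop : X.det * B.det = (rows (Sum.elim 0 (B 0)) (Sum.elim 0 (B 1))).det := by
    rw [← det_fromBlocks_zero₂₁ X Y B, hrows]
    rfl
  rw [hrows, hsplit, hsplit, hleft, hright, hright, htop, hrows Z K]
  ring

end Determinant

section PosSemidef

open scoped ComplexOrder MatrixOrder Pointwise

variable {𝕜 n : Type*} [RCLike 𝕜]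

theorem isClosed_setOf_posSemidef [Finite n] :
    IsClosed {A : Matrix n n 𝕜 | A.PosSemidef} := by
  cases nonempty_fintype n
  simp only [posSemidef_iff_dotProduct_mulVec, IsHermitian, Set.ofPred_and, Set.ofPred_forall]
  exact (isClosed_eq (by fun_prop) continuous_id).inter
    (isClosed_iInter fun x => isClosed_le continuous_const (by fun_prop))

theorem trace_mul_nonneg [Fintype n] {A B : Matrix n n 𝕜} (hA : A.PosSemidef) (hB : B.PosSemidef) :
    0 ≤ (A * B).trace := by
  classical
  obtain ⟨C, rfl⟩ := CStarAlgebra.nonneg_iff_eq_star_mul_self.mp hB.nonneg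
  rw [star_eq_conjTranspose, ← mul_assoc, trace_mul_comm, ← mul_assoc]
  exact (hA.mul_mul_conjTranspose_same C).trace_nonneg

theorem eq_zero_of_trace_mul_eq_zero [Fintype n] {A B : Matrix n n 𝕜} (hA : A.PosDef)
    (hB : B.PosSemidef) (h : (A * B).trace = 0) : B = 0 := by
  classical
  obtain ⟨C, hC, rfl⟩ :=
    CStarAlgebra.isStrictlyPositive_iff_eq_star_mul_self.mp hA.isStrictlyPositive
  rw [star_eq_conjTranspose, mul_assoc, trace_mul_comm,
    (hB.mul_mul_conjTranspose_same C).trace_eq_zero_iff] at h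
  rwa [← star_eq_conjTranspose, hC.star.mul_left_eq_zero, hC.mul_right_eq_zero] at h

theorem abs_apply_le_trace [Fintype n] {A : Matrix n n ℝ} (hA : A.PosSemidef) (i j : n) :
    |A i j| ≤ A.trace := by
  classical
  have hsymm : A j i = A i j := hA.1.apply i j
  have hplus := hA.dotProduct_mulVec_nonneg (Pi.single i 1 + Pi.single j 1)
  have hminus := hA.dotProduct_mulVec_nonneg (Pi.single i 1 - Pi.single j 1)
  have hdiag (k : n) : A k k ≤ A.trace :=
    Finset.single_le_sum (f := A.diag) (fun _ _ => hA.diag_nonneg) (Finset.mem_univ k)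
  simp only [star_trivial, mulVec_add, mulVec_sub, add_dotProduct, sub_dotProduct, dotProduct_add,
    dotProduct_sub, single_one_dotProduct, mulVec_single_one, col_apply, hsymm] at hplus hminus
  exact abs_le.2 ⟨by linarith [hdiag i, hdiag j], by linarith [hdiag i, hdiag j]⟩

theorem isCompact_setOf_posSemidef_trace_le [Fintype n] (t : ℝ) :
    IsCompact {A : Matrix n n ℝ | A.PosSemidef ∧ A.trace ≤ t} := by
  refine (isCompact_univ_pi fun _ => isCompact_univ_pi fun _ => isCompact_Icc
    (a := -t) (b := t)).of_isClosed_subset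
    (isClosed_setOf_posSemidef.inter (isClosed_le continuous_id.matrix_trace continuous_const)) ?_
  rintro A ⟨hA, hAt⟩ i - j -
  exact abs_le.1 ((abs_apply_le_trace hA i j).trans hAt)

theorem exists_mem_closure_posSemidef_sub [Finite n] {R : Set (Matrix n n ℝ)}
    (hR : ∀ p ∈ R, p.PosSemidef) {δ : Matrix n n ℝ}
    (hδ : δ ∈ closure {δ | ∃ p ∈ R, (δ - p).PosSemidef}) :
    ∃ p ∈ closure R, (δ - p).PosSemidef := by
  cases nonempty_fintype n
  set U := {A : Matrix n n ℝ | A.trace < δ.trace + 1} with hU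
  set K := closure R ∩ {A : Matrix n n ℝ | A.PosSemidef ∧ A.trace ≤ δ.trace + 1}
  have hUopen : IsOpen U := isOpen_lt (by fun_prop) continuous_const
  have hclosed : IsClosed (K + {A : Matrix n n ℝ | A.PosSemidef}) :=
    isClosed_setOf_posSemidef.add_left_of_isCompact
      ((isCompact_setOf_posSemidef_trace_le _).inter_left isClosed_closure)
  have hsub : U ∩ {A | ∃ p ∈ R, (A - p).PosSemidef} ⊆
      K + {A : Matrix n n ℝ | A.PosSemidef} := by
    rintro A ⟨hAU, p, hp, hAp⟩
    have htrace : p.trace ≤ A.trace := sub_nonneg.1 (trace_sub A p ▸ hAp.trace_nonneg)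
    exact ⟨p, ⟨subset_closure hp, hR p hp, htrace.trans (le_of_lt hAU)⟩, A - p, hAp,
      add_sub_cancel p A⟩
  obtain ⟨p, ⟨hp, -⟩, E, hE, rfl⟩ :=
    closure_minimal hsub hclosed (hUopen.inter_closure ⟨by simp [hU], hδ⟩)
  exact ⟨p, hp, by simpa using hE⟩

theorem posSemidef_blockDiagonal {o : Type*} [Finite n] [Finite o] [DecidableEq o]
    {B : o → Matrix n n 𝕜} (hB : ∀ k, (B k).PosSemidef) : (blockDiagonal B).PosSemidef := by
  classical
  cases nonempty_fintype n
  cases nonempty_fintype o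
  choose C hC using fun k => CStarAlgebra.nonneg_iff_eq_star_mul_self.mp (hB k).nonneg
  obtain rfl : B = fun k => (C k)ᴴ * C k := funext hC
  rw [blockDiagonal_mul, ← blockDiagonal_conjTranspose]
  exact posSemidef_conjTranspose_mul_self _

end PosSemidef

section Pure

variable {m n o : Type*} [Fintype m] [Fintype n]

/-- `γ` is the covariance matrix of a pure Gaussian state for the symplectic form `J`, here an
arbitrary matrix. The uncertainty equality is written without an inverse, as `γ J γ = J`, which
is a closed condition; for an invertible `J` it forces `γ` to be strictly positive. -/
structure IsPure (J γ : Matrix n n ℝ) : Prop where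
  posSemidef : γ.PosSemidef
  mul_mul : γ * J * γ = J

namespace IsPure

variable {J γ : Matrix n n ℝ}

theorem posDef [DecidableEq n] (h : IsPure J γ) (hJ : IsUnit J) : γ.PosDef := by
  refine h.posSemidef.posDef_iff_isUnit.2 ?_
  rw [isUnit_iff_isUnit_det] at hJ ⊢
  rw [← h.mul_mul, det_mul] at hJ
  exact isUnit_of_mul_isUnit_right hJ

theorem det_eq_one [DecidableEq n] (h : IsPure J γ) (hJ : IsUnit J) : γ.det = 1 := by
  have hdet : γ.det ^ 2 * J.det = 1 * J.det := by
    rw [one_mul]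
    conv_rhs => rw [← h.mul_mul, det_mul, det_mul]
    ring
  have hsq := mul_right_cancel₀ ((isUnit_iff_isUnit_det J).1 hJ).ne_zero hdet
  nlinarith [(h.posDef hJ).det_pos]

theorem neg_form (h : IsPure J γ) : IsPure (-J) γ :=
  ⟨h.posSemidef, by rw [mul_neg, neg_mul, h.mul_mul]⟩

theorem congr_mul {K : Matrix m m ℝ} (h : IsPure J γ) {S : Matrix m n ℝ} (hS : Sᵀ * K * S = J)
    (hS' : S * J * Sᵀ = K) : IsPure K (S * γ * Sᵀ) where
  posSemidef := h.posSemidef.mul_mul_conjTranspose_same S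
  mul_mul := calc
    S * γ * Sᵀ * K * (S * γ * Sᵀ) = S * (γ * (Sᵀ * K * S) * γ) * Sᵀ := by
      simp only [Matrix.mul_assoc]
    _ = K := by rw [hS, h.mul_mul, hS']

theorem submatrix_equiv (h : IsPure J γ) (e : m ≃ n) :
    IsPure (J.submatrix e e) (γ.submatrix e e) :=
  ⟨h.posSemidef.submatrix e, by rw [submatrix_mul_equiv, submatrix_mul_equiv, h.mul_mul]⟩

theorem blockDiagonal [Fintype o] [DecidableEq o] {J γ : o → Matrix n n ℝ}
    (h : ∀ k, IsPure (J k) (γ k)) : IsPure (blockDiagonal J) (blockDiagonal γ) :=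
  ⟨posSemidef_blockDiagonal fun k => (h k).posSemidef, by
    simp_rw [← blockDiagonal_mul, (h _).mul_mul]⟩

/-- With `E = γ - p`, the two purity equations give `E J γ = -p J E`. Hence the traces of
`(Jᵀ E J) γ` and `(Jᵀ p J) E`, which are both nonnegative, are opposite. -/
theorem eq_of_posSemidef_sub [DecidableEq n] {p : Matrix n n ℝ} (hp : IsPure J p)
    (hγ : IsPure J γ) (hJ : IsUnit J) (h : (γ - p).PosSemidef) : γ = p := by
  have hsum : (Jᵀ * (γ - p) * J) * γ + (Jᵀ * p * J) * (γ - p) = 0 := by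
    have hγ' : Jᵀ * (γ * J * γ) = Jᵀ * J := by rw [hγ.mul_mul]
    have hp' : Jᵀ * (p * J * p) = Jᵀ * J := by rw [hp.mul_mul]
    simp only [← Matrix.mul_assoc] at hγ' hp'
    simp only [Matrix.mul_sub, Matrix.sub_mul, hγ', hp']
    abel
  have hfirst := trace_mul_nonneg (h.conjTranspose_mul_mul_same J) hγ.posSemidef
  have hpJ : (Jᵀ * p * J).PosDef := (hp.posDef hJ).conjTranspose_mul_mul_same
    (mulVec_injective_of_isUnit hJ)
  have hsecond := trace_mul_nonneg hpJ.posSemidef h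
  have htrace := congrArg trace hsum
  rw [trace_add, trace_zero] at htrace
  rw [conjTranspose_eq_transpose_of_trivial] at hfirst
  exact sub_eq_zero.1 (eq_zero_of_trace_mul_eq_zero hpJ h (by linarith))

end IsPure

theorem isClosed_setOf_isPure (J : Matrix n n ℝ) : IsClosed {γ | IsPure J γ} := by
  have : {γ | IsPure J γ} = {γ | γ.PosSemidef ∧ γ * J * γ = J} :=
    Set.ext fun γ => ⟨fun h => ⟨h.1, h.2⟩, fun h => ⟨h.1, h.2⟩⟩
  rw [this]
  exact isClosed_setOf_posSemidef.inter (isClosed_eq (by fun_prop) continuous_const)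

end Pure

section Conditional

variable {k m n : Type*} [Fintype n] [DecidableEq n]

/-- The Schur complement `Γ_ff - Γ_fh (Γ_hh + g)⁻¹ Γ_hf`: the covariance matrix of the part `f` of
the system after the part `h` has been projected onto a Gaussian state, where `g` is the covariance
matrix of that state (up to a reflection of the momenta, which is left to the user). -/
noncomputable def condCM (Γ : Matrix k k ℝ) (f : m → k) (h : n → k) (g : Matrix n n ℝ) :
    Matrix m m ℝ :=
  Γ.submatrix f f - Γ.submatrix f h * (Γ.submatrix h h + g)⁻¹ * Γ.submatrix h f

variable {Γ Δ : Matrix k k ℝ} {f : m → k} {h : n → k} {g : Matrix n n ℝ}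

theorem posSemidef_condCM_sub_iff [Finite m] (hΓ : Γ.IsHermitian)
    (hg : (Γ.submatrix h h + g).PosDef) (p : Matrix m m ℝ) :
    (condCM Γ f h g - p).PosSemidef ↔
      (Γ.submatrix (Sum.elim f h) (Sum.elim f h) + fromBlocks (-p) 0 0 g).PosSemidef := by
  cases nonempty_fintype m
  have := hg.isUnit.invertible
  have hblocks : Γ.submatrix (Sum.elim f h) (Sum.elim f h) + fromBlocks (-p) 0 0 g =
      fromBlocks (Γ.submatrix f f - p) (Γ.submatrix f h) (Γ.submatrix f h)ᴴ
        (Γ.submatrix h h + g) := by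
    rw [conjTranspose_submatrix, hΓ, sub_eq_add_neg]
    ext (i | i) (j | j) <;> simp
  rw [hblocks, hg.fromBlocks₂₂, conjTranspose_submatrix, hΓ, condCM, sub_right_comm]

theorem posSemidef_condCM_sub_condCM [Finite m] (hΔ : Δ.PosSemidef) (hg : g.PosDef)
    (hΓΔ : (Γ - Δ).PosSemidef) : (condCM Γ f h g - condCM Δ f h g).PosSemidef := by
  have hΓ : Γ.PosSemidef := by simpa using hΓΔ.add hΔ
  have hself := (posSemidef_condCM_sub_iff (f := f) hΔ.1
    (hg.posSemidef_add (hΔ.submatrix h)) (condCM Δ f h g)).1 (by simpa using PosSemidef.zero)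
  refine (posSemidef_condCM_sub_iff hΓ.1 (hg.posSemidef_add (hΓ.submatrix h)) _).2 ?_
  convert (hΓΔ.submatrix (Sum.elim f h)).add hself using 1
  rw [submatrix_sub, ← add_assoc]
  simp

theorem posSemidef_condCM [Finite m] (hΓ : Γ.PosSemidef) (hg : g.PosDef) :
    (condCM Γ f h g).PosSemidef := by
  simpa [condCM] using posSemidef_condCM_sub_condCM (f := f) (h := h) PosSemidef.zero hg
    (show (Γ - 0).PosSemidef by simpa using hΓ)

/-- The Schur complement of `G` is `V' G V` for the row `V' = (1, -C W)` and the column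
`V = (1, -W C')`, and `V' G` and `G V` are again explicit, so the identity for `G` is compressed by
`V'` and `V`. -/
theorem schur_mul_mul_schur [Fintype m] {A Jm : Matrix m m ℝ} {C : Matrix m n ℝ}
    {C' : Matrix n m ℝ} {B W Jn : Matrix n n ℝ} (hW : (B + g) * W = 1) (hg : g * Jn * g = Jn)
    (hG : fromBlocks A C C' B * fromBlocks Jm 0 0 Jn * fromBlocks A C C' B =
      fromBlocks Jm 0 0 Jn) :
    (A - C * W * C') * Jm * (A - C * W * C') = Jm := by
  classical
  set V := fromRows (1 : Matrix m m ℝ) (-(W * C'))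
  set V' := fromCols (1 : Matrix m m ℝ) (-(C * W))
  have hBW : B * W = 1 - g * W := by rw [← hW]; noncomm_ring
  have hWB : W * B = 1 - W * g := by rw [← mul_eq_one_comm.1 hW]; noncomm_ring
  have hright : fromBlocks A C C' B * V = fromRows (A - C * W * C') (g * W * C') := by
    rw [fromBlocks_mul_fromRows, Matrix.mul_one, Matrix.mul_one, Matrix.mul_neg, Matrix.mul_neg,
      ← Matrix.mul_assoc, ← Matrix.mul_assoc, hBW, Matrix.sub_mul, Matrix.one_mul]
    congr 1
    abel
  have hleft : V' * fromBlocks A C C' B = fromCols (A - C * W * C') (C * W * g) := by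
    rw [fromCols_mul_fromBlocks, Matrix.one_mul, Matrix.one_mul, Matrix.neg_mul, Matrix.neg_mul,
      Matrix.mul_assoc C W B, hWB, Matrix.mul_sub, Matrix.mul_one, ← Matrix.mul_assoc]
    congr 1
    abel
  have hcompress : V' * fromBlocks A C C' B * fromBlocks Jm 0 0 Jn * (fromBlocks A C C' B * V) =
      V' * fromBlocks Jm 0 0 Jn * V := by
    conv_rhs => rw [← hG]
    simp only [Matrix.mul_assoc]
  have hcorner : C * W * g * Jn * (g * W * C') = C * W * Jn * (W * C') := by
    conv_rhs => rw [← hg]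
    simp only [Matrix.mul_assoc]
  rw [hleft, hright, fromCols_mul_fromBlocks, fromCols_mul_fromBlocks, fromCols_mul_fromRows,
    fromCols_mul_fromRows] at hcompress
  simpa [hcorner, Matrix.neg_mul, Matrix.mul_neg] using hcompress

theorem IsPure.condCM [Fintype k] [Fintype m] {J : Matrix k k ℝ} {Jm : Matrix m m ℝ}
    {Jn : Matrix n n ℝ} (hΓ : IsPure J Γ) (hg : IsPure Jn g) (hJn : IsUnit Jn)
    (hfh : (Sum.elim f h).Bijective)
    (hJ : J.submatrix (Sum.elim f h) (Sum.elim f h) = fromBlocks Jm 0 0 Jn) :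
    IsPure Jm (condCM Γ f h g) := by
  have hgpos := hg.posDef hJn
  refine ⟨posSemidef_condCM hΓ.posSemidef hgpos, ?_⟩
  have hG := (hΓ.submatrix_equiv (Equiv.ofBijective _ hfh)).mul_mul
  have hblocks : Γ.submatrix (Sum.elim f h) (Sum.elim f h) = fromBlocks (Γ.submatrix f f)
      (Γ.submatrix f h) (Γ.submatrix h f) (Γ.submatrix h h) := by
    ext (i | i) (j | j) <;> rfl
  rw [Equiv.coe_ofBijective, hJ, hblocks] at hG
  have hunit := (hgpos.posSemidef_add (hΓ.posSemidef.submatrix h)).isUnit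
  exact schur_mul_mul_schur (mul_nonsing_inv _ ((isUnit_iff_isUnit_det _).1 hunit)) hg.mul_mul hG

end Conditional

section OneMode

/-- The symplectic form `J₁` of a single mode. -/
def modeJ : Matrix (Fin 2) (Fin 2) ℝ := !![0, -1; 1, 0]

theorem modeJ_transpose : modeJᵀ = -modeJ := by
  ext i j
  fin_cases i <;> fin_cases j <;> simp [modeJ]

theorem modeJ_mul_self : modeJ * modeJ = -1 := by
  ext i j
  fin_cases i <;> fin_cases j <;> simp [modeJ]

theorem isUnit_modeJ : IsUnit modeJ := by
  simp [isUnit_iff_isUnit_det, modeJ, det_fin_two]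

theorem mul_modeJ_mul_transpose (X : Matrix (Fin 2) (Fin 2) ℝ) :
    X * modeJ * Xᵀ = X.det • modeJ := by
  ext i j
  fin_cases i <;> fin_cases j <;>
    simp [modeJ, mul_apply, Fin.sum_univ_two, det_fin_two] <;> ring

theorem isPure_modeJ_of_det_eq_one {B : Matrix (Fin 2) (Fin 2) ℝ} (hB : B.PosSemidef)
    (hdet : B.det = 1) : IsPure modeJ B := by
  refine ⟨hB, ?_⟩
  have h := mul_modeJ_mul_transpose B
  rwa [← conjTranspose_eq_transpose_of_trivial, hB.1, hdet, one_smul] at h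

theorem isUnit_fromBlocks_modeJ : IsUnit (fromBlocks modeJ 0 0 modeJ) :=
  isUnit_fromBlocks_zero₂₁.2 ⟨isUnit_modeJ, isUnit_modeJ⟩

/-- Purity couples the blocks of a two-mode state through `A J₁ X + X J₁ B = 0`, which gives
`-(det X) A = (X J₁) B (X J₁)ᵀ`; now compare traces. -/
theorem IsPure.det_toBlocks₁₂_nonpos {G : Matrix (Fin 2 ⊕ Fin 2) (Fin 2 ⊕ Fin 2) ℝ}
    (h : IsPure (fromBlocks modeJ 0 0 modeJ) G) : G.toBlocks₁₂.det ≤ 0 := by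
  set A := G.toBlocks₁₁
  set X := G.toBlocks₁₂
  set B := G.toBlocks₂₂
  have hcouple : A * modeJ * X + X * modeJ * B = 0 := by
    have hG := congrArg toBlocks₁₂ h.mul_mul
    rw [← fromBlocks_toBlocks G, fromBlocks_multiply, fromBlocks_multiply] at hG
    simpa using hG
  have hcongr : -(X.det • A) = X * modeJ * B * (X * modeJ)ᵀ := by
    rw [eq_neg_of_add_eq_zero_right hcouple, transpose_mul, modeJ_transpose]
    calc -(X.det • A) = A * modeJ * (X.det • modeJ) := by
          rw [Matrix.mul_smul, Matrix.mul_assoc, modeJ_mul_self, mul_neg, mul_one, smul_neg]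
      _ = _ := by
          rw [← mul_modeJ_mul_transpose]
          simp only [Matrix.mul_assoc, Matrix.neg_mul, Matrix.mul_neg, neg_neg]
  have hA : 0 < A.trace :=
    ((h.posDef isUnit_fromBlocks_modeJ).submatrix Sum.inl_injective).trace_pos
  have hB : 0 ≤ (X * modeJ * B * (X * modeJ)ᵀ).trace :=
    ((h.posSemidef.submatrix Sum.inr).mul_mul_conjTranspose_same _).trace_nonneg
  rw [← hcongr, trace_neg, trace_smul, smul_eq_mul] at hB
  nlinarith

end OneMode

section Modes

variable {M m n α : Type*} [DecidableEq M]

/-- The matrix with the blocks `B x` along the diagonal, the block label coming first in the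
index as in phase space (`Matrix.blockDiagonal` puts it last). -/
def modeDiagonal [Zero α] (B : M → Matrix m n α) : Matrix (M × m) (M × n) α :=
  (blockDiagonal B).submatrix Prod.swap Prod.swap

theorem modeDiagonal_apply [Zero α] (B : M → Matrix m n α) (x y : M) (i : m) (j : n) :
    modeDiagonal B (x, i) (y, j) = if x = y then B x i j else 0 :=
  rfl

theorem modeDiagonal_transpose [Zero α] (B : M → Matrix m n α) :
    (modeDiagonal B)ᵀ = modeDiagonal fun x => (B x)ᵀ :=
  congrArg (submatrix · Prod.swap Prod.swap) (blockDiagonal_transpose B)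

theorem one_kronecker_eq_modeDiagonal [MulZeroOneClass α] (B : Matrix m n α) :
    (1 : Matrix M M α) ⊗ₖ B = modeDiagonal fun _ => B :=
  one_kronecker B

theorem sympJ_eq_modeDiagonal : sympJ M = modeDiagonal fun _ => modeJ :=
  one_kronecker_eq_modeDiagonal modeJ

theorem sympJ_submatrix {i j : M} (hij : i ≠ j) :
    (sympJ M).submatrix (Sum.elim (Prod.mk i) (Prod.mk j)) (Sum.elim (Prod.mk i) (Prod.mk j)) =
      fromBlocks modeJ 0 0 modeJ := by
  ext (q | q) (r | r) <;> simp [sympJ_eq_modeDiagonal, modeDiagonal_apply, hij, hij.symm]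

variable [Fintype M]

theorem modeBlock_modeDiagonal_mul_mul_modeDiagonal (B C : M → Matrix (Fin 2) (Fin 2) ℝ)
    (A : Matrix (M × Fin 2) (M × Fin 2) ℝ) (i j : M) :
    modeBlock (modeDiagonal B * A * modeDiagonal C) i j = B i * modeBlock A i j * C j := by
  ext q r
  simp [modeBlock, mul_apply, modeDiagonal_apply, Fintype.sum_prod_type, ite_mul, mul_ite]

theorem sympJ_mul_self : sympJ M * sympJ M = -1 := by
  have h : sympJ M = 1 ⊗ₖ modeJ := rfl
  rw [h, ← mul_kronecker_mul, one_mul, modeJ_mul_self, ← neg_one_smul ℝ 1, kronecker_smul,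
    one_kronecker_one, neg_one_smul]

theorem isUnit_sympJ : IsUnit (sympJ M) :=
  IsUnit.of_mul_eq_one (-sympJ M) (by rw [mul_neg, sympJ_mul_self, neg_neg])

theorem IsPure.inv_eq {γ : Matrix (M × Fin 2) (M × Fin 2) ℝ} (h : IsPure (sympJ M) γ) :
    γ⁻¹ = -(sympJ M * γ * sympJ M) := by
  refine inv_eq_right_inv ?_
  rw [mul_neg, ← mul_assoc, ← mul_assoc, h.mul_mul, sympJ_mul_self, neg_neg]

theorem IsPure.det_modeBlock_inv {γ : Matrix (M × Fin 2) (M × Fin 2) ℝ}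
    (h : IsPure (sympJ M) γ) (i j : M) : (modeBlock γ⁻¹ i j).det = (modeBlock γ i j).det := by
  have hblock : modeBlock γ⁻¹ i j = -(modeJ * modeBlock γ i j * modeJ) := by
    rw [h.inv_eq, sympJ_eq_modeDiagonal]
    exact congrArg Neg.neg (modeBlock_modeDiagonal_mul_mul_modeDiagonal _ _ γ i j)
  rw [hblock, det_neg, det_mul, det_mul]
  simp [modeJ]

theorem isPureCM_iff_isPure {γ : Matrix (M × Fin 2) (M × Fin 2) ℝ} :
    IsPureCM γ ↔ IsPure (sympJ M) γ := by
  constructor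
  · rintro ⟨hγ, h⟩
    refine ⟨hγ.posSemidef, ?_⟩
    have hdet := (isUnit_iff_isUnit_det γ).1 hγ.isUnit
    calc γ * sympJ M * γ = -(sympJ M * γ⁻¹ * sympJ M) * sympJ M * γ := by
          rw [← eq_neg_of_add_eq_zero_left h]
      _ = sympJ M := by
          rw [neg_mul, mul_assoc (sympJ M * γ⁻¹), sympJ_mul_self, mul_neg_one, neg_neg, mul_assoc,
            nonsing_inv_mul γ hdet, mul_one]
  · intro h
    refine ⟨h.posDef isUnit_sympJ, ?_⟩
    rw [h.inv_eq, mul_neg, neg_mul, ← mul_assoc, ← mul_assoc, mul_assoc, sympJ_mul_self]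
    simp

end Modes

section ThreeModes

variable {i j k : Fin 3}

theorem bijective_sumElim_mk (hij : i ≠ j) (hik : i ≠ k) (hjk : j ≠ k) :
    (Sum.elim (Sum.elim (Prod.mk i) (Prod.mk j)) (Prod.mk k) :
      (Fin 2 ⊕ Fin 2) ⊕ Fin 2 → Fin 3 × Fin 2).Bijective := by
  refine (Fintype.bijective_iff_injective_and_card _).2 ⟨?_, rfl⟩
  refine ((Prod.mk_right_injective i).sumElim (Prod.mk_right_injective j) ?_).sumElim
    (Prod.mk_right_injective k) ?_
  · simp [hij]
  · rintro (q | q) r <;> simp [hik, hjk]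

theorem det_modeBlock_inv_mul_det {A : CM3} (hA : IsUnit A.det) (hij : i ≠ j) (hik : i ≠ k)
    (hjk : j ≠ k) :
    (modeBlock A⁻¹ i j).det * A.det =
      (fromBlocks (modeBlock A i j) (modeBlock A i k) (modeBlock A k j) (modeBlock A k k)).det := by
  let r := Equiv.ofBijective _ (bijective_sumElim_mk hik hij hjk.symm)
  let c := Equiv.ofBijective _ (bijective_sumElim_mk hjk hij.symm hik.symm)
  let σ : Equiv.Perm ((Fin 2 ⊕ Fin 2) ⊕ Fin 2) :=
    Equiv.swap (Sum.inl (Sum.inl 0)) (Sum.inr 0) * Equiv.swap (Sum.inl (Sum.inl 1)) (Sum.inr 1)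
  have hσ : A.submatrix r c = (A.submatrix c c).submatrix σ id := by
    have : (r : _ → Fin 3 × Fin 2) = c ∘ σ := by
      ext1 ((q | q) | q) <;> fin_cases q <;> rfl
    rw [this]
    rfl
  have hdet : (A.submatrix r c).det = A.det := by
    rw [hσ, det_permute, det_submatrix_equiv_self, Equiv.Perm.sign_mul, Equiv.Perm.sign_swap,
      Equiv.Perm.sign_swap]
    all_goals simp
  rw [← hdet]
  refine (det_submatrix_inv_mul_det_submatrix hA r c).trans (congrArg det ?_)
  ext (q | q) (q' | q') <;> rfl

theorem sympJ_submatrix_three (hij : i ≠ j) (hik : i ≠ k) (hjk : j ≠ k) :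
    (sympJ (Fin 3)).submatrix (Sum.elim (Sum.elim (Prod.mk i) (Prod.mk j)) (Prod.mk k))
        (Sum.elim (Sum.elim (Prod.mk i) (Prod.mk j)) (Prod.mk k)) =
      fromBlocks (fromBlocks modeJ 0 0 modeJ) 0 0 modeJ := by
  ext ((q | q) | q) ((r | r) | r) <;>
    simp [sympJ_eq_modeDiagonal, modeDiagonal_apply, hij, hij.symm, hik, hik.symm, hjk, hjk.symm]

variable {γ : CM3} {B : Matrix (Fin 2) (Fin 2) ℝ}

/-- Up to a positive factor this is the off-diagonal determinant of the pure two-mode state left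
when mode `k` is projected onto the pure state `B`. -/
theorem det_fromBlocks_add_nonpos_of_det_eq_one (hγ : IsPure (sympJ (Fin 3)) γ) (hij : i ≠ j)
    (hik : i ≠ k) (hjk : j ≠ k) (hB : B.PosDef) (hdet : B.det = 1) :
    (fromBlocks (modeBlock γ i j) (modeBlock γ i k) (modeBlock γ k j)
      (modeBlock γ k k + B)).det ≤ 0 := by
  have hD : (modeBlock γ k k + B).PosDef := hB.posSemidef_add (hγ.posSemidef.submatrix _)
  have := hD.isUnit.invertible
  have hpure := hγ.condCM (isPure_modeJ_of_det_eq_one hB.posSemidef hdet) isUnit_modeJ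
    (bijective_sumElim_mk hij hik hjk) (sympJ_submatrix_three hij hik hjk)
  rw [det_fromBlocks₂₂, invOf_eq_nonsing_inv]
  exact mul_nonpos_of_nonneg_of_nonpos hD.det_pos.le hpure.det_toBlocks₁₂_nonpos

/-- Along the ray `t • B₁` with `det B₁ = 1` the determinant is a quadratic in `t` whose constant
and leading coefficients both equal `d = det γ_ij`: the constant one by Jacobi's identity, because
`γ⁻¹ = -J γ J`. Such a quadratic is `d (t - 1)²` plus `t` times its value at `t = 1`. -/
theorem det_fromBlocks_add_nonpos (hγ : IsPure (sympJ (Fin 3)) γ) (hij : i ≠ j) (hik : i ≠ k)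
    (hjk : j ≠ k) (hd : (modeBlock γ i j).det ≤ 0) (hB : B.PosDef) :
    (fromBlocks (modeBlock γ i j) (modeBlock γ i k) (modeBlock γ k j)
      (modeBlock γ k k + B)).det ≤ 0 := by
  set s := √B.det with hs
  have hs0 : 0 < s := Real.sqrt_pos.2 hB.det_pos
  set B₁ := s⁻¹ • B with hB₁
  have hdet : B₁.det = 1 := by
    rw [hB₁, det_smul, Fintype.card_fin, inv_pow, hs, Real.sq_sqrt hB.det_pos.le,
      inv_mul_cancel₀ hB.det_pos.ne']
  have hBs : B = s • B₁ := by rw [hB₁, smul_inv_smul₀ hs0.ne']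
  have hconst : (fromBlocks (modeBlock γ i j) (modeBlock γ i k) (modeBlock γ k j)
      (modeBlock γ k k)).det = (modeBlock γ i j).det := by
    have hγdet := hγ.det_eq_one isUnit_sympJ
    rw [← det_modeBlock_inv_mul_det (hγdet ▸ isUnit_one) hij hik hjk, hγdet, mul_one,
      hγ.det_modeBlock_inv]
  obtain ⟨q, hq⟩ := det_fromBlocks_add_smul (modeBlock γ i j) (modeBlock γ i k)
    (modeBlock γ k j) (modeBlock γ k k) B₁
  have hone := det_fromBlocks_add_nonpos_of_det_eq_one hγ hij hik hjk
    (hB.smul (inv_pos.2 hs0)) hdet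
  rw [← one_smul ℝ (s⁻¹ • B), hq, hconst, hdet] at hone
  rw [hBs, hq, hconst, hdet]
  nlinarith [mul_nonpos_of_nonpos_of_nonneg hd (sq_nonneg (s - 1))]

end ThreeModes

section LocalOperations

variable {γ : CM3} {G : Fin 3 → LocalCJ}

/-- The phase-space index of port `a` of the party and quadrature given by `k`. -/
def portIndex (a : Fin 2) (k : Fin 3 × Fin 2) : (Fin 3 × Fin 2) × Fin 2 := ((k.1, a), k.2)

theorem output_eq_condCM {Γ : CJ3} (hΓ : Γ.IsHermitian) (γ : CM3) :
    output Γ γ = condCM Γ (portIndex 0) (portIndex 1) (Lam * γ * Lam) := by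
  have hoff : (portBlock Γ 0 1)ᵀ = Γ.submatrix (portIndex 1) (portIndex 0) := by
    rw [portBlock, transpose_submatrix, ← conjTranspose_eq_transpose_of_trivial, hΓ]
    rfl
  rw [output, hoff]
  rfl

theorem bijective_sumElim_portIndex : (Sum.elim (portIndex 0) (portIndex 1)).Bijective := by
  refine (Fintype.bijective_iff_injective_and_card _).2 ⟨?_, rfl⟩
  unfold Function.Injective
  decide

theorem sympJ_submatrix_portIndex :
    (sympJ (Fin 3 × Fin 2)).submatrix (Sum.elim (portIndex 0) (portIndex 1))
        (Sum.elim (portIndex 0) (portIndex 1)) =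
      fromBlocks (sympJ (Fin 3)) 0 0 (sympJ (Fin 3)) := by
  ext (⟨x, q⟩ | ⟨x, q⟩) (⟨y, r⟩ | ⟨y, r⟩) <;>
    simp [sympJ_eq_modeDiagonal, modeDiagonal_apply, portIndex]

theorem Lam_eq_modeDiagonal : Lam = modeDiagonal fun _ => sigmaZ :=
  one_kronecker_eq_modeDiagonal sigmaZ

theorem sigmaZ_transpose : sigmaZᵀ = sigmaZ := by
  ext i j
  fin_cases i <;> fin_cases j <;> rfl

theorem sigmaZ_mul_modeJ_mul_sigmaZ : sigmaZ * modeJ * sigmaZ = -modeJ := by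
  simp [sigmaZ, modeJ]

theorem Lam_transpose : Lamᵀ = Lam := by
  rw [Lam_eq_modeDiagonal, modeDiagonal_transpose, sigmaZ_transpose]

theorem Lam_mul_sympJ_mul_Lam : Lam * sympJ (Fin 3) * Lam = -sympJ (Fin 3) := by
  have h : sympJ (Fin 3) = 1 ⊗ₖ modeJ := rfl
  rw [h, Lam, ← mul_kronecker_mul, ← mul_kronecker_mul, sigmaZ_mul_modeJ_mul_sigmaZ, mul_one,
    mul_one, ← neg_one_smul ℝ modeJ, kronecker_smul, neg_one_smul]

theorem isPure_Lam_mul_mul_Lam (h : IsPure (sympJ (Fin 3)) γ) :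
    IsPure (sympJ (Fin 3)) (Lam * γ * Lam) := by
  have := h.congr_mul (K := -sympJ (Fin 3)) (S := Lam) ?_ ?_
  · simpa [Lam_transpose] using this.neg_form
  · rw [Lam_transpose, mul_neg, neg_mul, Lam_mul_sympJ_mul_Lam, neg_neg]
  · rw [Lam_transpose, Lam_mul_sympJ_mul_Lam]

theorem isPure_localSum (hG : ∀ x, IsPure (sympJ (Fin 2)) (G x)) :
    IsPure (sympJ (Fin 3 × Fin 2)) (localSum G) := by
  have h := (IsPure.blockDiagonal hG).submatrix_equiv
    ((Equiv.prodAssoc (Fin 3) (Fin 2) (Fin 2)).trans (Equiv.prodComm _ _))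
  convert h using 1
  · ext ⟨⟨x, a⟩, q⟩ ⟨⟨y, b⟩, r⟩
    simp [sympJ_eq_modeDiagonal, modeDiagonal_apply, blockDiagonal_apply, ite_and]
  · rfl

theorem isPure_output {Γ : CJ3} (hΓ : IsPure (sympJ (Fin 3 × Fin 2)) Γ)
    (hγ : IsPure (sympJ (Fin 3)) γ) : IsPure (sympJ (Fin 3)) (output Γ γ) := by
  rw [output_eq_condCM hΓ.posSemidef.1]
  exact hΓ.condCM (isPure_Lam_mul_mul_Lam hγ) isUnit_sympJ bijective_sumElim_portIndex
    sympJ_submatrix_portIndex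

theorem portBlock_localSum (G : Fin 3 → LocalCJ) (a b : Fin 2) :
    portBlock (localSum G) a b = modeDiagonal fun x => modeBlock (G x) a b :=
  rfl

theorem det_modeBlock_nonpos_of_isPure {G : LocalCJ} (hG : IsPure (sympJ (Fin 2)) G) :
    (modeBlock G 0 1).det ≤ 0 := by
  have hbij : (Sum.elim (Prod.mk 0) (Prod.mk 1) : Fin 2 ⊕ Fin 2 → Fin 2 × Fin 2).Bijective := by
    refine (Fintype.bijective_iff_injective_and_card _).2 ⟨?_, rfl⟩
    exact (Prod.mk_right_injective 0).sumElim (Prod.mk_right_injective 1) (by simp)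
  have h := hG.submatrix_equiv (Equiv.ofBijective _ hbij)
  rw [Equiv.coe_ofBijective, sympJ_submatrix zero_ne_one] at h
  exact h.det_toBlocks₁₂_nonpos

theorem nonposDets_inv_add_modeDiagonal (hγ : IsPure (sympJ (Fin 3)) γ)
    (hn : NonposDets γ) {B : Fin 3 → Matrix (Fin 2) (Fin 2) ℝ} (hB : ∀ x, (B x).PosDef) :
    NonposDets (γ + modeDiagonal B)⁻¹ := by
  intro i j hij
  obtain ⟨k, hik, hjk⟩ : ∃ k, i ≠ k ∧ j ≠ k := by decide +revert
  have hM : (γ + modeDiagonal B).PosDef :=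
    (hγ.posDef isUnit_sympJ).add_posSemidef
      ((posSemidef_blockDiagonal fun x => (hB x).posSemidef).submatrix _)
  have hjacobi := det_modeBlock_inv_mul_det hM.det_pos.ne'.isUnit hij hik hjk
  have hblock (x y : Fin 3) : modeBlock (γ + modeDiagonal B) x y =
      modeBlock γ x y + if x = y then B x else 0 := by
    ext q r
    by_cases hxy : x = y <;> simp [modeBlock, modeDiagonal_apply, hxy]
  simp only [hblock, hij, hik, hjk.symm, if_false, if_true, add_zero] at hjacobi
  have := det_fromBlocks_add_nonpos hγ hij hik hjk (hn i j hij) (hB k)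
  exact nonpos_of_mul_nonpos_left (hjacobi.trans_le this) hM.det_pos

theorem nonposDets_Lam_mul_mul_Lam (hn : NonposDets γ) : NonposDets (Lam * γ * Lam) := by
  intro i j hij
  rw [Lam_eq_modeDiagonal, modeBlock_modeDiagonal_mul_mul_modeDiagonal, det_mul, det_mul]
  simpa [sigmaZ] using hn i j hij

theorem nonposDets_output (hG : ∀ x, IsPure (sympJ (Fin 2)) (G x))
    (hγ : IsPure (sympJ (Fin 3)) γ) (hn : NonposDets γ) :
    NonposDets (output (localSum G) γ) := by
  intro i j hij
  set C := fun x => modeBlock (G x) 0 1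
  set M := Lam * γ * Lam + modeDiagonal fun x => modeBlock (G x) 1 1 with hM
  have hout : modeBlock (output (localSum G) γ) i j = -(C i * modeBlock M⁻¹ i j * (C j)ᵀ) := by
    rw [← modeBlock_modeDiagonal_mul_mul_modeDiagonal C fun x => (C x)ᵀ, ← modeDiagonal_transpose,
      output, portBlock_localSum, portBlock_localSum, portBlock_localSum, add_comm, ← hM]
    ext q r
    simp [modeBlock, modeDiagonal_apply, hij, C]
  have hinv : (modeBlock M⁻¹ i j).det ≤ 0 :=
    nonposDets_inv_add_modeDiagonal (isPure_Lam_mul_mul_Lam hγ) (nonposDets_Lam_mul_mul_Lam hn)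
      (fun x => ((hG x).posDef isUnit_sympJ).submatrix (Prod.mk_right_injective 1)) i j hij
  have hC : 0 ≤ (C i).det * (C j).det := mul_nonneg_of_nonpos_of_nonpos
    (det_modeBlock_nonpos_of_isPure (hG i)) (det_modeBlock_nonpos_of_isPure (hG j))
  rw [hout, det_neg, det_mul, det_mul, det_transpose, Fintype.card_fin]
  nlinarith

theorem isClosed_setOf_nonposDets {M : Type*} :
    IsClosed {γ : Matrix (M × Fin 2) (M × Fin 2) ℝ | NonposDets γ} := by
  simp only [NonposDets, Set.ofPred_forall]
  exact isClosed_iInter fun i => isClosed_iInter fun j => isClosed_iInter fun _ =>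
    isClosed_le (by unfold modeBlock; fun_prop) continuous_const

theorem PureReaches.nonposDets {γ' : CM3} (h : PureReaches γ γ') (hγ : IsPure (sympJ (Fin 3)) γ)
    (hn : NonposDets γ) : NonposDets γ' := by
  refine closure_minimal ?_ isClosed_setOf_nonposDets h
  rintro _ ⟨Γ, ⟨G, hG, rfl⟩, rfl⟩
  exact nonposDets_output (fun x => isPureCM_iff_isPure.1 (hG x)) hγ hn

theorem Reaches.pureReaches {γ' : CM3} (h : Reaches γ γ') (hγ : IsPure (sympJ (Fin 3)) γ)
    (hγ' : IsPure (sympJ (Fin 3)) γ') : PureReaches γ γ' := by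
  set R := {δ | ∃ Γ, IsPureGLOCC Γ ∧ δ = output Γ γ}
  have hR : R ⊆ {p | IsPure (sympJ (Fin 3)) p} := by
    rintro _ ⟨Γ, ⟨G, hG, rfl⟩, rfl⟩
    exact isPure_output (isPure_localSum fun x => isPureCM_iff_isPure.1 (hG x)) hγ
  have hsub : {δ | ∃ Γ, IsGLOCC Γ ∧ δ = output Γ γ} ⊆ {δ | ∃ p ∈ R, (δ - p).PosSemidef} := by
    rintro _ ⟨Γ, ⟨G, hG, hΓ⟩, rfl⟩
    have hG' := isPure_localSum fun x => isPureCM_iff_isPure.1 (hG x)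
    refine ⟨_, ⟨localSum G, ⟨G, hG, rfl⟩, rfl⟩, ?_⟩
    rw [output_eq_condCM (by simpa using (hΓ.add hG'.posSemidef).1),
      output_eq_condCM hG'.posSemidef.1]
    exact posSemidef_condCM_sub_condCM hG'.posSemidef
      ((isPure_Lam_mul_mul_Lam hγ).posDef isUnit_sympJ) hΓ
  obtain ⟨p, hp, hle⟩ :=
    exists_mem_closure_posSemidef_sub (fun p hp => (hR hp).posSemidef) (closure_mono hsub h)
  have hpure : IsPure (sympJ (Fin 3)) p := closure_minimal hR (isClosed_setOf_isPure _) hp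
  rwa [PureReaches, hpure.eq_of_posSemidef_sub hγ' isUnit_sympJ hle]

end LocalOperations

section Examples

theorem isPure_kronecker_add_kronecker {M : Type*} [Fintype M] [DecidableEq M]
    {A B : Matrix M M ℝ} (hA : A.PosDef) (hAB : A * B = 1) :
    IsPure (sympJ M) (A ⊗ₖ !![1, 0; 0, 0] + B ⊗ₖ !![0, 0; 0, 1]) := by
  have hB : B.PosDef := inv_eq_right_inv hAB ▸ hA.inv
  set X : Matrix (Fin 2) (Fin 2) ℝ := !![1, 0; 0, 0]
  set P : Matrix (Fin 2) (Fin 2) ℝ := !![0, 0; 0, 1]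
  have hX : X.PosSemidef := by
    convert posSemidef_vecMulVec_self_star (![1, 0] : Fin 2 → ℝ) using 1
    ext i j
    fin_cases i <;> fin_cases j <;> simp [X, vecMulVec]
  have hP : P.PosSemidef := by
    convert posSemidef_vecMulVec_self_star (![0, 1] : Fin 2 → ℝ) using 1
    ext i j
    fin_cases i <;> fin_cases j <;> simp [P, vecMulVec]
  have hXX : X * modeJ * X = 0 := by
    ext i j
    fin_cases i <;> fin_cases j <;> simp [X, modeJ]
  have hPP : P * modeJ * P = 0 := by
    ext i j
    fin_cases i <;> fin_cases j <;> simp [P, modeJ]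
  have hXP : X * modeJ * P + P * modeJ * X = modeJ := by simp [X, P, modeJ]
  have hJ : sympJ M = 1 ⊗ₖ modeJ := rfl
  refine ⟨(hA.posSemidef.kronecker hX).add (hB.posSemidef.kronecker hP), ?_⟩
  simp only [hJ, Matrix.add_mul, Matrix.mul_add, ← mul_kronecker_mul, Matrix.mul_one, hAB,
    mul_eq_one_comm.1 hAB, hXX, hPP, kronecker_zero, zero_add, add_zero]
  rw [← kronecker_add, add_comm, hXP]

theorem symEntry_add {l : ℝ} (hl : l ≠ 0) :
    l * (symEntry 1 l + symEntry (-1) l) = (l ^ 2 - 1) / 2 := by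
  rw [symEntry, symEntry]
  field_simp
  ring

variable {l : ℝ}

theorem symEntry_mul (hl : 1 ≤ l) : symEntry 1 l * symEntry (-1) l = -(l ^ 2 - 1) / 2 := by
  have hl2 : 1 ≤ l ^ 2 := one_le_pow₀ hl
  have hsqrt := Real.sq_sqrt (show 0 ≤ 9 * l ^ 4 - 10 * l ^ 2 + 1 by nlinarith)
  rw [symEntry, symEntry]
  generalize √(9 * l ^ 4 - 10 * l ^ 2 + 1) = w at hsqrt ⊢
  field_simp
  linear_combination -2 * hsqrt

theorem symEntry_one_nonneg (hl : 1 ≤ l) : 0 ≤ symEntry 1 l :=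
  div_nonneg (by nlinarith [Real.sqrt_nonneg (9 * l ^ 4 - 10 * l ^ 2 + 1)]) (by linarith)

theorem symEntry_one_lt (hl : 1 ≤ l) : symEntry 1 l < l := by
  have hsqrt : √(9 * l ^ 4 - 10 * l ^ 2 + 1) ≤ 3 * l ^ 2 - 1 :=
    Real.sqrt_le_iff.2 ⟨by nlinarith, by nlinarith⟩
  rw [symEntry, div_lt_iff₀ (by linarith)]
  nlinarith

theorem isPure_symState (hl : 1 ≤ l) : IsPure (sympJ (Fin 3)) (symState l) := by
  set d := symEntry 1 l
  set d' := symEntry (-1) l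
  have hsum : l * (d + d') = (l ^ 2 - 1) / 2 := symEntry_add (by linarith)
  have hprod : d * d' = -(l ^ 2 - 1) / 2 := symEntry_mul hl
  have hA : !![l, d, d; d, l, d; d, d, l].PosDef := by
    have hdiag : (diagonal fun _ : Fin 3 => l - d).PosDef :=
      .diagonal fun _ => sub_pos.2 (symEntry_one_lt hl)
    convert hdiag.add_posSemidef
      ((posSemidef_vecMulVec_self_star (1 : Fin 3 → ℝ)).smul (symEntry_one_nonneg hl)) using 1
    ext i j
    fin_cases i <;> fin_cases j <;> simp [d]
  convert isPure_kronecker_add_kronecker (B := !![l, d', d'; d', l, d'; d', d', l]) hA ?_ using 1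
  · ext ⟨i, q⟩ ⟨j, r⟩
    fin_cases i <;> fin_cases j <;> fin_cases q <;> fin_cases r <;> simp [symState, d, d']
  · have hone : l * l + d * d' + d * d' = 1 := by linear_combination 2 * hprod
    have hzero : l * d' + d * l + d * d' = 0 := by linear_combination hsum + hprod
    ext i j
    fin_cases i <;> fin_cases j <;> simp <;> linarith [hone, hzero]

theorem nonposDets_symState (hl : 1 ≤ l) : NonposDets (symState l) := by
  intro i j hij
  have hdet : (modeBlock (symState l) i j).det = symEntry 1 l * symEntry (-1) l := by
    fin_cases i <;> fin_cases j <;> first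
      | exact absurd rfl hij
      | simp [modeBlock, det_fin_two, symState]
  rw [hdet, symEntry_mul hl]
  nlinarith

/-- The hyperbolic rotation of the modes `0`, `1`: two-mode squeezing acts by it on the
positions, and by its inverse on the momenta. -/
noncomputable def hyperbolicRotation (s : ℝ) : Matrix (Fin 3) (Fin 3) ℝ :=
  !![Real.cosh s, Real.sinh s, 0; Real.sinh s, Real.cosh s, 0; 0, 0, 1]

theorem hyperbolicRotation_mul (s t : ℝ) :
    hyperbolicRotation s * hyperbolicRotation t = hyperbolicRotation (s + t) := by
  ext i j
  fin_cases i <;> fin_cases j <;>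
    simp [hyperbolicRotation, mul_apply, Fin.sum_univ_three, Real.cosh_add, Real.sinh_add] <;> ring

theorem hyperbolicRotation_zero : hyperbolicRotation 0 = 1 := by
  ext i j
  fin_cases i <;> fin_cases j <;> simp [hyperbolicRotation]

theorem hyperbolicRotation_mul_neg (s : ℝ) :
    hyperbolicRotation s * hyperbolicRotation (-s) = 1 := by
  rw [hyperbolicRotation_mul, add_neg_cancel, hyperbolicRotation_zero]

theorem hyperbolicRotation_transpose (s : ℝ) :
    (hyperbolicRotation s)ᵀ = hyperbolicRotation s := by
  ext i j
  fin_cases i <;> fin_cases j <;> rfl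

theorem posDef_hyperbolicRotation (s : ℝ) : (hyperbolicRotation s).PosDef := by
  have hunit := IsUnit.of_mul_eq_one _ (hyperbolicRotation_mul_neg (s / 2))
  have h := PosDef.conjTranspose_mul_self _ (mulVec_injective_of_isUnit hunit)
  rwa [conjTranspose_eq_transpose_of_trivial, hyperbolicRotation_transpose,
    hyperbolicRotation_mul, add_halves] at h

theorem isPure_tmsVacuum (s : ℝ) : IsPure (sympJ (Fin 3)) (tmsVacuum s) := by
  convert isPure_kronecker_add_kronecker (posDef_hyperbolicRotation s)
    (hyperbolicRotation_mul_neg s) using 1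
  ext ⟨i, q⟩ ⟨j, r⟩
  fin_cases i <;> fin_cases j <;> fin_cases q <;> fin_cases r <;>
    simp [tmsVacuum, hyperbolicRotation, sigmaZ]

theorem transpose_kronecker_one_mul_sympJ_mul {M : Type*} [Fintype M] [DecidableEq M]
    {R : Matrix M M ℝ} (hR : Rᵀ * R = 1) :
    (R ⊗ₖ (1 : Matrix (Fin 2) (Fin 2) ℝ))ᵀ * sympJ M * (R ⊗ₖ 1) = sympJ M := by
  rw [sympJ, ← kroneckerMap_transpose, ← mul_kronecker_mul, ← mul_kronecker_mul, Matrix.mul_one,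
    hR, transpose_one, Matrix.one_mul, Matrix.mul_one]

theorem isPure_distributedTMS (s θ : ℝ) : IsPure (sympJ (Fin 3)) (distributedTMS s θ) := by
  set R : Matrix (Fin 3) (Fin 3) ℝ :=
    !![1, 0, 0; 0, Real.cos θ, Real.sin θ; 0, -Real.sin θ, Real.cos θ] with hR
  have hRR : Rᵀ * R = 1 := by
    have := Real.sin_sq_add_cos_sq θ
    ext i j
    fin_cases i <;> fin_cases j <;> simp [hR, mul_apply, Fin.sum_univ_three] <;> linarith
  refine (isPure_tmsVacuum s).congr_mul (transpose_kronecker_one_mul_sympJ_mul hRR) ?_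
  have h := transpose_kronecker_one_mul_sympJ_mul (R := Rᵀ)
    (by rw [transpose_transpose, mul_eq_one_comm.1 hRR])
  have hB : Rᵀ ⊗ₖ 1 = (beamSplitter θ)ᵀ := by
    rw [beamSplitter, ← kroneckerMap_transpose, transpose_one]
  rwa [hB, transpose_transpose] at h

theorem det_modeBlock_distributedTMS (s θ : ℝ) :
    (modeBlock (distributedTMS s θ) 1 2).det =
      (Real.sin θ * Real.cos θ * (1 - Real.cosh s)) ^ 2 := by
  simp [modeBlock, det_fin_two, distributedTMS, beamSplitter, tmsVacuum, sigmaZ, mul_apply,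
    Fintype.sum_prod_type, Fin.sum_univ_three]
  ring

end Examples

end GLOCC

theorem mainTheorem6 :
    -- from a pure state whose three determinants are non-positive, no positive one arises
    (∀ γ : GLOCC.CM3, GLOCC.IsPureCM γ → GLOCC.NonposDets γ →
      (∀ γ' : GLOCC.CM3, GLOCC.PureReaches γ γ' → GLOCC.NonposDets γ') ∧
      (∀ γ' : GLOCC.CM3, GLOCC.Reaches γ γ' → GLOCC.IsPureCM γ' → GLOCC.NonposDets γ')) ∧
    -- no symmetric state reaches a distributed two-mode squeezed state
    (∀ s θ : ℝ, 0 < s → Real.sin θ * Real.cos θ ≠ 0 →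
      GLOCC.IsPureCM (GLOCC.distributedTMS s θ) ∧
      ∀ l : ℝ, 1 ≤ l → ¬ GLOCC.Reaches (GLOCC.symState l) (GLOCC.distributedTMS s θ)) := by
  simp only [GLOCC.isPureCM_iff_isPure]
  refine ⟨fun γ hγ hn => ⟨fun γ' h => h.nonposDets hγ hn,
    fun γ' h hγ' => (h.pureReaches hγ hγ').nonposDets hγ hn⟩, fun s θ hs hθ =>
    ⟨GLOCC.isPure_distributedTMS s θ, fun l hl h => ?_⟩⟩
  have hsym := GLOCC.isPure_symState hl
  have hreach := h.pureReaches hsym (GLOCC.isPure_distributedTMS s θ)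
  have hnonpos := hreach.nonposDets hsym (GLOCC.nonposDets_symState hl) 1 2 (by decide)
  have hcosh : 1 - Real.cosh s ≠ 0 := (sub_neg.2 (Real.one_lt_cosh.2 hs.ne')).ne
  have hpos := sq_pos_of_ne_zero (mul_ne_zero hθ hcosh)
  rw [GLOCC.det_modeBlock_distributedTMS] at hnonpos
  exact hnonpos.not_gt hpos
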